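/- A cartesian closed category is a category with finite products in which, for every object $T$, the functor $T\times(-)$ has a right adjoint $(-)^T$; an object $T$ of such a category is called atomic if the exponential functor $(-)^T$ itself has a right adjoint. Let $E=\{1,e\}$ be the monoid with unit $1$ and exactly one other element $e$, which is idempotent ($e^2=e$), regarded as a category with one object, and let $\mathbf{Set}^E$ be the topos of functors $E\to\mathbf{Set}$. Then $\mathbf{Set}^E$ has no atomic objects except the terminal object $1$; that is, an object $T$ of $\mathbf{Set}^E$ is atomic if and only if $T$ is terminal (isomorphic to $1$). -/

import Mathlib

open CategoryTheory CategoryTheory.Limits MonoidalCategory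

universe u v w

/-- The monoid `{1, e}` whose only non-identity element `e` is idempotent. -/
inductive IdemMonoid : Type
  | one : IdemMonoid
  | e : IdemMonoid

namespace IdemMonoid

/-- Multiplication: `1` is the unit and `e * e = e`. -/
def mul : IdemMonoid → IdemMonoid → IdemMonoid
  | one, y => y
  | e, _ => e

instance : Monoid IdemMonoid where
  mul := mul
  one := one
  mul_assoc := by rintro (_ | _) (_ | _) (_ | _) <;> rfl
  one_mul := by rintro (_ | _) <;> rfl
  mul_one := by rintro (_ | _) <;> rfl

end IdemMonoid

/-- The topos `Set^E` of functors from the one-object category of `E = {1, e}` to sets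
(sets of an arbitrary universe `u`). -/
abbrev SetE : Type (u + 1) := SingleObj IdemMonoid ⥤ Type u

/-- `Set^E` is cartesian closed: its tensor product is the cartesian product, and `ihom T` is the
exponential functor `(-)^T`, right adjoint to `T × (-)`. -/
noncomputable instance : MonoidalClosed SetE.{u} :=
  FunctorToTypes.monoidalClosed.{u, 0, 0}

/-- An object `T` of a cartesian closed category is atomic if the exponential functor `(-)^T`
(itself a right adjoint of the product functor `T × (-)`) has a right adjoint `(-)_T`. -/
def IsAtomicObject {C : Type v} [Category.{w} C] [CartesianMonoidalCategory C]
    [MonoidalClosed C] (T : C) : Prop :=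
  (ihom T).IsLeftAdjoint

/-! If `(-)^T` is a left adjoint, it preserves jointly epimorphic families. Elements of `Y^T` are
maps `T × E ⟶ Y`, with `E` the free object on one generator, so every such map factors through one
member of any cover of `Y`. The empty cover of the empty object forces `T` to have a point; the
cover of a wedge of two copies of `E` forbids two points. Conversely, `1 × (-)` is isomorphic to the
identity, hence so is its right adjoint. -/

namespace SetE

/-- The set with idempotent endomorphism `f`, as a functor. -/
def ofIdem {X : Type u} (f : X → X) (hf : ∀ x, f (f x) = f x) : SetE.{u} where
  obj _ := X
  map m := match m with
    | IdemMonoid.one => 𝟙 X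
    | IdemMonoid.e => ↾f
  map_id _ := rfl
  map_comp := by
    rintro _ _ _ (_ | _) (_ | _)
    · rfl
    · rfl
    · rfl
    · ext x
      exact (hf x).symm

/-- The action of the idempotent `e`. -/
def idem (Y : SetE.{u}) : Y.obj (SingleObj.star IdemMonoid) → Y.obj (SingleObj.star IdemMonoid) :=
  Y.map (X := SingleObj.star IdemMonoid) (Y := SingleObj.star IdemMonoid) IdemMonoid.e

/-- An equivariant map, as a natural transformation. -/
def homMk {X Y : SetE.{u}}
    (g : X.obj (SingleObj.star IdemMonoid) → Y.obj (SingleObj.star IdemMonoid))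
    (hg : ∀ x, g (idem X x) = idem Y (g x)) : X ⟶ Y where
  app _ := ↾g
  naturality := by
    rintro ⟨⟩ ⟨⟩ (_ | _)
    · exact (congrArg (· ≫ ↾g) (X.map_id _)).trans (congrArg (↾g ≫ ·) (Y.map_id _)).symm
    · ext x
      exact hg x

lemma hom_ext {X Y : SetE.{u}} {f g : X ⟶ Y}
    (h : ∀ x, f.app (SingleObj.star IdemMonoid) x = g.app (SingleObj.star IdemMonoid) x) :
    f = g := by
  ext ⟨⟩ x
  exact h x

lemma app_idem {X Y : SetE.{u}} (f : X ⟶ Y) (x : X.obj (SingleObj.star IdemMonoid)) :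
    f.app _ (idem X x) = idem Y (f.app _ x) :=
  NatTrans.naturality_apply f (X := SingleObj.star IdemMonoid) (Y := SingleObj.star IdemMonoid)
    IdemMonoid.e x

lemma idem_idem (Y : SetE.{u}) (y : Y.obj (SingleObj.star IdemMonoid)) :
    idem Y (idem Y y) = idem Y y :=
  (ConcreteCategory.congr_hom (Y.map_comp (X := SingleObj.star IdemMonoid)
    (Y := SingleObj.star IdemMonoid) (Z := SingleObj.star IdemMonoid)
    IdemMonoid.e IdemMonoid.e) y).symm

/-- The free object on one generator: `true` is the unit of the monoid and `false` is `e`. -/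
def free : SetE.{u} := ofIdem (X := ULift.{u} Bool) (fun _ => ⟨false⟩) (fun _ => rfl)

/-- The generator of the free object. -/
def gen : free.{u}.obj (SingleObj.star IdemMonoid) := ULift.up true

/-- The map out of the free object determined by an element. -/
def freeDesc {Y : SetE.{u}} (y : Y.obj (SingleObj.star IdemMonoid)) : free ⟶ Y :=
  homMk (fun b : ULift Bool => if b.down then y else idem Y y) (by
    intro (b : ULift Bool)
    change idem Y y = idem Y (if b.down then y else idem Y y)
    split_ifs
    · rfl
    · exact (idem_idem Y y).symm)

lemma free_hom_ext {Y : SetE.{u}} {f g : free ⟶ Y} (h : f.app _ gen = g.app _ gen) : f = g := by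
  apply hom_ext
  rintro ⟨_ | _⟩
  · exact (app_idem f gen).trans ((congrArg (idem Y) h).trans (app_idem g gen).symm)
  · exact h

end SetE

/-- A left adjoint functor between categories of type-valued functors sends jointly epimorphic
families to jointly surjective ones. -/
lemma jointly_surjective_map_of_isLeftAdjoint {C : Type v} [Category.{w} C]
    {D : Type*} [Category D] (F : D ⥤ C ⥤ Type u) [F.IsLeftAdjoint]
    {ι : Type*} {X : ι → D} {Y : D} (p : ∀ i, X i ⟶ Y)
    (hp : ∀ {Z : D} (h k : Y ⟶ Z), (∀ i, p i ≫ h = p i ≫ k) → h = k)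
    (c : C) (y : (F.obj Y).obj c) : ∃ i x, (F.map (p i)).app c x = y := by
  let S : Subfunctor (F.obj Y) := ⨆ i, Subfunctor.range (F.map (p i))
  have hS : Epi S.ι := by
    -- Maps that agree on `S` have adjoint transposes that agree after each `p i`, hence are equal.
    refine ⟨fun {Z} h k hhk => ?_⟩
    let adj := Adjunction.ofIsLeftAdjoint F
    apply (adj.homEquiv Y Z).injective
    apply hp
    intro i
    rw [← adj.homEquiv_naturality_left, ← adj.homEquiv_naturality_left]
    congr 1
    have hi : Subfunctor.range (F.map (p i)) ≤ S :=
      le_iSup (fun i => Subfunctor.range (F.map (p i))) i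
    rw [← Subfunctor.lift_ι (F.map (p i)) hi, Category.assoc, Category.assoc, hhk]
  have htop : S = ⊤ := by
    rw [← Subfunctor.range_ι S]
    exact Subfunctor.range_eq_top S.ι
  have hy : y ∈ S.obj c := by rw [htop]; trivial
  simpa [S] using hy

/-- If `T` is atomic, every map from `T × E` to an object covered by a jointly epimorphic family
lifts to a member of the family. -/
lemma IsAtomicObject.exists_lift {T : SetE.{u}} (hT : IsAtomicObject T)
    {ι : Type*} {X : ι → SetE.{u}} {Y : SetE.{u}} (p : ∀ i, X i ⟶ Y)
    (hp : ∀ {Z : SetE.{u}} (h k : Y ⟶ Z), (∀ i, p i ≫ h = p i ≫ k) → h = k)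
    (φ : T ⊗ SetE.free ⟶ Y) : ∃ i, ∃ ψ : T ⊗ SetE.free ⟶ X i, ψ ≫ p i = φ := by
  have : (ihom T).IsLeftAdjoint := hT
  obtain ⟨i, x, hx⟩ := jointly_surjective_map_of_isLeftAdjoint (ihom T) p hp _
    ((MonoidalClosed.curry φ).app _ SetE.gen)
  -- The preimage `x` in `(X i)^T` extends freely to a map out of `E`, whose transpose is the lift.
  refine ⟨i, MonoidalClosed.uncurry (SetE.freeDesc x), ?_⟩
  rw [← MonoidalClosed.uncurry_natural_right,
    show SetE.freeDesc x ≫ (ihom T).map (p i) = MonoidalClosed.curry φ from SetE.free_hom_ext hx,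
    MonoidalClosed.uncurry_curry]

namespace SetE

/-- If `T` is empty, `T × E` maps to the empty object, whose empty cover has no member to lift to.
-/
lemma nonempty_of_isAtomicObject {T : SetE.{u}} (hT : IsAtomicObject T) :
    Nonempty (T.obj (SingleObj.star IdemMonoid)) := by
  by_contra hne
  rw [not_nonempty_iff] at hne
  let Y : SetE.{u} := ofIdem (X := PEmpty.{u + 1}) id (fun _ => rfl)
  obtain ⟨i, -⟩ := hT.exists_lift (ι := PEmpty.{1}) (X := fun _ => Y) (Y := Y) (fun i => i.elim)
    (fun h k _ => hom_ext fun (x : PEmpty) => x.elim)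
    (homMk (fun x : T.obj _ × _ => hne.elim x.1) (fun x : T.obj _ × _ => hne.elim x.1))
  exact i.elim

/-- The wedge of two copies of the free object: `none` is the common fixed point. -/
def wedge : SetE.{u} := ofIdem (X := ULift.{u} (Option Bool)) (fun _ => ⟨none⟩) (fun _ => rfl)

/-- The two inclusions of the free object into the wedge. -/
def wedgeIncl (i : Bool) : free.{u} ⟶ wedge.{u} :=
  freeDesc (Y := wedge) (ULift.up (some i))

lemma wedge_hom_ext {Z : SetE.{u}} (h k : wedge ⟶ Z)
    (hhk : ∀ i, wedgeIncl i ≫ h = wedgeIncl i ≫ k) : h = k := by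
  have key (i : Bool) (b : ULift.{u} Bool) :
      h.app _ ((wedgeIncl i).app (SingleObj.star IdemMonoid) b) =
        k.app _ ((wedgeIncl i).app (SingleObj.star IdemMonoid) b) :=
    ConcreteCategory.congr_hom (NatTrans.congr_app (hhk i) (SingleObj.star IdemMonoid)) b
  apply hom_ext
  rintro ⟨_ | i⟩
  -- Both inclusions reach the fixed point; `true` is an arbitrary choice.
  · exact key true ⟨false⟩
  · exact key i ⟨true⟩

lemma wedgeIncl_app_ne (i : Bool) (b : ULift.{u} Bool) :
    (wedgeIncl i).app (SingleObj.star IdemMonoid) b ≠ ULift.up (some !i) := by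
  obtain ⟨_ | _⟩ := b
  · intro h
    cases congrArg ULift.down h
  · intro h
    have h' : some i = some (!i) := congrArg ULift.down h
    simp at h'

open Classical in
/-- The map from `T × E` to the wedge sending `(t, 1)` to the element `true` if `t = t₀` and to
`false` otherwise, and every `(t, e)` to the fixed point. -/
noncomputable def toWedge {T : SetE.{u}} (t₀ : T.obj (SingleObj.star IdemMonoid)) :
    T ⊗ free ⟶ wedge :=
  homMk (fun x : T.obj _ × ULift.{u} Bool =>
    ULift.up (if x.2.down then some (decide (x.1 = t₀)) else none)) (fun _ => rfl)

-- For `t₁ ≠ t₀`, `toWedge t₀` hits both generators of the wedge, while each inclusion misses one.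
open Classical in
lemma subsingleton_of_isAtomicObject {T : SetE.{u}} (hT : IsAtomicObject T) :
    Subsingleton (T.obj (SingleObj.star IdemMonoid)) := by
  refine ⟨fun t₀ t₁ => ?_⟩
  by_contra hne
  obtain ⟨i, ψ, hψ⟩ := hT.exists_lift wedgeIncl wedge_hom_ext (toWedge t₀)
  have key (x : T.obj (SingleObj.star IdemMonoid) × ULift.{u} Bool) :
      (toWedge t₀).app (SingleObj.star IdemMonoid) x ≠ ULift.up (some !i) := by
    rw [← hψ]
    exact wedgeIncl_app_ne i (ψ.app (SingleObj.star IdemMonoid) x)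
  cases i
  · exact key (t₀, ⟨true⟩) (congrArg (fun b => ULift.up (some b)) (decide_eq_true rfl))
  · exact key (t₁, ⟨true⟩) (congrArg (fun b => ULift.up (some b)) (decide_eq_false (Ne.symm hne)))

lemma nonempty_isTerminal (T : SetE.{u}) (h₀ : Nonempty (T.obj (SingleObj.star IdemMonoid)))
    (h₁ : Subsingleton (T.obj (SingleObj.star IdemMonoid))) : Nonempty (IsTerminal T) :=
  ⟨IsTerminal.ofUniqueHom (fun _ => homMk (fun _ => h₀.some) (fun _ => Subsingleton.elim _ _))
    (fun _ _ => hom_ext fun _ => Subsingleton.elim _ _)⟩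

end SetE

/-- A terminal object of a cartesian closed category is atomic. -/
lemma CategoryTheory.Limits.IsTerminal.isAtomicObject {C : Type v} [Category.{w} C]
    [CartesianMonoidalCategory C] [MonoidalClosed C] {T : C} (hT : IsTerminal T) :
    IsAtomicObject T := by
  let e : T ≅ 𝟙_ C := hT.uniqueUpToIso CartesianMonoidalCategory.isTerminalTensorUnit
  let α : tensorLeft T ≅ 𝟭 C := (tensoringLeft C).mapIso e ≪≫ leftUnitorNatIso C
  have : (tensorLeft T).IsEquivalence := Functor.isEquivalence_of_iso α.symm
  have : (ihom T).IsEquivalence := (ihom.adjunction T).isEquivalence_right_of_isEquivalence_left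
  exact Functor.isLeftAdjoint_of_isEquivalence

theorem theoremT (T : SetE.{u}) : IsAtomicObject T ↔ Nonempty (IsTerminal T) := by
  refine ⟨fun hT => ?_, fun ⟨hT⟩ => hT.isAtomicObject⟩
  exact SetE.nonempty_isTerminal T (SetE.nonempty_of_isAtomicObject hT)
    (SetE.subsingleton_of_isAtomicObject hT)
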